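/- Let $k$ be an algebraically closed field of characteristic $0$ and let $a,b\ge 1$ be integers. On the polynomial ring $B=k[x_1,x_2,x_3,y_1,y_2,y_3,v]$ consider the $k$-linear derivation $$D=x_1^a\frac{\partial}{\partial y_1}+x_2^a\frac{\partial}{\partial y_2}+x_3^a\frac{\partial}{\partial y_3}+(y_1y_2y_3)^b\frac{\partial}{\partial v},$$ and let $B^D=\{f\in B: D(f)=0\}$. Then $D$ is locally nilpotent, and $$B^D\subseteq k\oplus (x_1,x_2,x_3)B .$$ Moreover, put $\theta(f)=\sum_{n\ge 0}\frac{D^n(f)}{n!}T^n\in B[T]$ for $f\in B$. Then the elements $$h_i=x_i^{(2b+1)a}\,\theta(v)\big|_{T=-y_i/x_i^a}\qquad(i=1,2,3)$$ of the field of fractions of $B$ lie in $B$, and the algebra $$A=k[x_1,x_2,x_3,\;x_1^ay_2-x_2^ay_1,\;x_1^ay_3-x_3^ay_1,\;x_2^ay_3-x_3^ay_2,\;h_1,h_2,h_3]$$ has the following properties. (1) $A$ is a separating algebra: $A\subseteq B^D$, and whenever two points $p,q\in k^7$ satisfy $f(p)\ne f(q)$ for some $f\in B^D$, there is $g\in A$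 with $g(p)\neq g(q)$. (2) $B^D$ is the ring of regular functions on the quasi-affine variety $\mathrm{Spec}(A)\setminus\mathcal V(x_1,x_2,x_3)$ (by an isomorphism that takes each element of $A$ to the regular function it defines). That is, with $I=(x_1,x_2,x_3)A$ and $Q(A)$ the field of fractions of $A$, $$B^D=\{q\in Q(A): qI^r\subseteq A\text{ for some } r\ge 1\}.$$ -/

import Mathlib

noncomputable section

namespace SevenDim

/-- The seven variables `x₁, x₂, x₃, y₁, y₂, y₃, v`. -/
abbrev Vars : Type := Fin 3 ⊕ Fin 3 ⊕ Unit

/-- The polynomial ring `B = k[x₁, x₂, x₃, y₁, y₂, y₃, v]`. -/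
abbrev B (k : Type*) [Field k] : Type _ := MvPolynomial Vars k

/-- The variable `xᵢ`. -/
def x (k : Type*) [Field k] (i : Fin 3) : B k := MvPolynomial.X (Sum.inl i)

/-- The variable `yᵢ`. -/
def y (k : Type*) [Field k] (i : Fin 3) : B k := MvPolynomial.X (Sum.inr (Sum.inl i))

/-- The variable `v`. -/
def v (k : Type*) [Field k] : B k := MvPolynomial.X (Sum.inr (Sum.inr ()))

/-- The derivation `D = ∑ xᵢ^a ∂/∂yᵢ + (y₁y₂y₃)^b ∂/∂v`. -/
def D (k : Type*) [Field k] (a b : ℕ) : Derivation k (B k) (B k) :=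
  (∑ i : Fin 3, x k i ^ a • MvPolynomial.pderiv (Sum.inr (Sum.inl i))) +
    (y k 0 * y k 1 * y k 2) ^ b • MvPolynomial.pderiv (Sum.inr (Sum.inr ()))

end SevenDim

/-- A derivation is locally nilpotent if each element is killed by some iterate of it. -/
def IsLND {k S : Type*} [Field k] [CommRing S] [Algebra k S] (D : Derivation k S S) : Prop :=
  ∀ f : S, ∃ m : ℕ, D^[m] f = 0

/-- The kernel `S^D` of a derivation `D` of `S`, as a subalgebra of `S`. -/
def Derivation.kernel {k S : Type*} [Field k] [CommRing S] [Algebra k S]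
    (D : Derivation k S S) : Subalgebra k S where
  carrier := {f | D f = 0}
  mul_mem' := by
    intro f g hf hg
    simp only [Set.mem_ofPred_eq] at hf hg ⊢
    simp [hf, hg]
  add_mem' := by
    intro f g hf hg
    simp only [Set.mem_ofPred_eq] at hf hg ⊢
    simp [hf, hg]
  algebraMap_mem' := by
    intro r
    simp

/-- The map `θ : S → S[T]`, `θ(f) = ∑ₖ (Dᵏ(f) / k!) Tᵏ`, describing the action of the additive
group that corresponds to `D`. The sum has finitely many nonzero terms when `D` is locally
nilpotent. -/
def Derivation.theta {k S : Type*} [Field k] [CommRing S] [Algebra k S]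
    (D : Derivation k S S) (f : S) : Polynomial S :=
  ∑ᶠ n : ℕ, Polynomial.monomial n ((Nat.factorial n : k)⁻¹ • D^[n] f)

/-- `A` is a separating algebra for a subalgebra `C` of the ring of polynomial functions on the
affine space `σ → k`: it is contained in `C`, and any two points that are separated by an element
of `C` are separated by an element of `A`. -/
def IsSeparatingAlgebra {k σ : Type*} [Field k] (A C : Subalgebra k (MvPolynomial σ k)) : Prop :=
  A ≤ C ∧ ∀ p q : σ → k, (∃ f ∈ C, MvPolynomial.eval p f ≠ MvPolynomial.eval q f) →
    ∃ g ∈ A, MvPolynomial.eval p g ≠ MvPolynomial.eval q g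

/-- The open subset `Spec(R) \ V(I)` of `Spec(R)`. -/
def specDiff {R : Type*} [CommRing R] (I : Ideal R) :
    (AlgebraicGeometry.Spec (CommRingCat.of R)).Opens :=
  ⟨(PrimeSpectrum.zeroLocus (I : Set R))ᶜ, (PrimeSpectrum.isClosed_zeroLocus _).isOpen_compl⟩

open AlgebraicGeometry CategoryTheory in
/-- The algebra `C`, which contains `A`, is the ring of regular functions on the quasi-affine
scheme `Spec(A) \ V(I)`, by an isomorphism that takes each element of `A` to the regular function
which it defines. -/
def IsRingOfRegularFunctions {k S : Type*} [Field k] [CommRing S] [Algebra k S]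
    (A C : Subalgebra k S) (I : Ideal A) : Prop :=
  ∃ (hA : A ≤ C) (e : C ≃+* Γ(Spec (CommRingCat.of A), specDiff I)),
    ∀ c : A, e (Subalgebra.inclusion hA c) =
      ((Scheme.ΓSpecIso (CommRingCat.of A)).inv ≫
        (Spec (CommRingCat.of A)).presheaf.map
          (homOfLE (le_top : specDiff I ≤ ⊤)).op).hom c

/-- The set `(A : I^∞)_{Q(A)}` for an ideal `I` of a subalgebra `A` of a domain `S`, where the field
of fractions `Q(A)` is taken inside the field of fractions of `S`: the elements `q` of `Q(A)` such
that `q I^r ⊆ A` for some `r ≥ 1`. -/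
def idealTransform {k S : Type*} [Field k] [CommRing S] [IsDomain S] [Algebra k S]
    (A : Subalgebra k S) (I : Ideal A) : Set (FractionRing S) :=
  {q | q ∈ Subfield.closure (algebraMap S (FractionRing S) '' (A : Set S)) ∧
    ∃ r : ℕ, 1 ≤ r ∧ ∀ g ∈ I ^ r, ∃ c ∈ A,
      q * algebraMap S (FractionRing S) (g : S) = algebraMap S (FractionRing S) c}

namespace SevenDim

/-- The ideal `(x₁, x₂, x₃)B`. -/
def xIdeal (k : Type*) [Field k] : Ideal (B k) := Ideal.span (Set.range (x k))

/-- The element `xᵢ^((2b+1)a) θ(v)|_{T = -yᵢ/xᵢ^a}` of the field of fractions of `B`. -/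
def hFrac (k : Type*) [Field k] (a b : ℕ) (i : Fin 3) : FractionRing (B k) :=
  algebraMap (B k) (FractionRing (B k)) (x k i) ^ ((2 * b + 1) * a) *
    Polynomial.aeval
      (-(algebraMap (B k) (FractionRing (B k)) (y k i)) /
        algebraMap (B k) (FractionRing (B k)) (x k i) ^ a)
      ((D k a b).theta (v k))

/-- The algebra generated by `x₁, x₂, x₃`, the three elements `xᵢ^a yⱼ - xⱼ^a yᵢ` with `i < j`, and
three further polynomials `h₁, h₂, h₃`. -/
def A (k : Type*) [Field k] (a : ℕ) (h : Fin 3 → B k) : Subalgebra k (B k) :=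
  Algebra.adjoin k
    {x k 0, x k 1, x k 2,
      x k 0 ^ a * y k 1 - x k 1 ^ a * y k 0,
      x k 0 ^ a * y k 2 - x k 2 ^ a * y k 0,
      x k 1 ^ a * y k 2 - x k 2 ^ a * y k 1,
      h 0, h 1, h 2}

/-- The ideal of `A` generated by `x₁, x₂, x₃`. -/
def xIdealA (k : Type*) [Field k] (a : ℕ) (h : Fin 3 → B k) : Ideal (A k a h) :=
  Ideal.span {g : A k a h | ∃ i, (g : B k) = x k i}

end SevenDim

end

/-! The flow of `D` carries (ξ, η, ν) along T ↦ (ξ, η + ξ^a T, ν + ∫₀ᵀ ∏ (ηⱼ + ξⱼ^a s)^b ds), a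
polynomial curve on which invariants are constant (`flow_eq_C`). For the generic point this curve is
θ, so local nilpotency only says that it is polynomial in T.

Invariants are constant on x = 0 by a degeneration (`aeval_add_eq_of_integral_eq_zero`). With ξ^a =
ω, start at x = εξ and flow for the time ε^(-a): y moves from η to η + ω, and v moves by ε^(-a) ∫₀¹
∏ (ηⱼ + ωⱼ s)^b ds. If this integral vanishes, v does not move, and ε → 0 shows that an invariant
agrees at (0, η, ν) and (0, η + ω, ν). Such segments join every η to 0, by solving for a root of a
polynomial whose leading coefficient is a beta integral. At x = 0, y = (1, 1, 1) the flow is a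
translation of v, which removes the dependence on ν.

Where xᵢ ≠ 0, the generic orbit meets yᵢ = 0 at T = -yᵢ/xᵢ^a. An invariant equals its value at that
point, whose coordinates lie in A after multiplication by powers of xᵢ; hence B^D and A agree after
inverting xᵢ (`exists_pow_mul_mem_A`). This separates points outside x = 0, while on x = 0 there is
nothing to separate. As x₁ and x₂ are coprime in B, B^D is the intersection of the rings A[1/xᵢ]
(`mem_image_kernel_iff`), which is both the ring of regular functions and the ideal transform. -/

/-! ### Regular functions as an intersection of localizations -/

open AlgebraicGeometry CategoryTheory in
/-- Let `U` be the complement of the common zeros of nonzero elements `sᵢ` of a domain `R`, and let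
`R` be embedded into a field `K`. The ring of regular functions on `U` is, compatibly with the
embedding of `R`, the ring of all `q ∈ K` such that for each `i` a multiple `sᵢ ^ N * q` lies
in `R`. -/
theorem exists_ringHom_regularFunctions {R : CommRingCat} [IsDomain R] {K : Type*} [Field K]
    (φ : R →+* K) (hφ : Function.Injective φ) {ι : Type} [Nonempty ι] (s : ι → R)
    (hs : ∀ i, s i ≠ 0) (U : (Spec R).Opens)
    (hU : ∀ p : PrimeSpectrum R, p ∈ U ↔ ∃ i, s i ∉ p.asIdeal) :
    ∃ ψ : Γ(Spec R, U) →+* K, Function.Injective ψ ∧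
      (∀ r : R, ψ (algebraMap R Γ(Spec R, U) r) = φ r) ∧
      ∀ q : K, q ∈ ψ.range ↔ ∀ i, ∃ (N : ℕ) (r : R), φ (s i) ^ N * q = φ r := by
  obtain ⟨V, hV, hloc⟩ : ∃ V : ι → (Spec R).Opens,
      (∀ i (p : PrimeSpectrum R), p ∈ V i ↔ s i ∉ p.asIdeal) ∧
        ∀ i, IsLocalization.Away (s i) Γ(Spec R, V i) :=
    ⟨fun i => PrimeSpectrum.basicOpen (s i), fun _ _ => Iff.rfl,
      fun i => inferInstance⟩
  have hgen : ∀ i, genericPoint (Spec R) ∈ V i := by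
    intro i
    rw [genericPoint_eq_bot_of_affine]
    exact (hV i _).2 (hs i)
  have hVU : ∀ i, V i ≤ U := fun i p hp => (hU p).2 ⟨i, (hV i p).1 hp⟩
  have hUV : U ≤ ⨆ i, V i := by
    intro p hp
    obtain ⟨i, hi⟩ := (hU p).1 hp
    exact TopologicalSpace.Opens.mem_iSup.2 ⟨i, (hV i p).2 hi⟩
  have hUg : genericPoint (Spec R) ∈ U := hVU (Classical.arbitrary ι) (hgen _)
  -- The function field is the field of fractions of R, and sections over a nonempty open set inject
  -- into it, so sections can be compared inside K.
  let lift : (Spec R).functionField →+* K := IsFractionRing.lift (A := R) hφ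
  have hgerm : ∀ (W : (Spec R).Opens) (hW : genericPoint (Spec R) ∈ W) (r : R),
      lift ((Spec R).presheaf.germ W _ hW (algebraMap R Γ(Spec R, W) r)) = φ r := by
    intro W hW r
    have : (Spec R).presheaf.germ W _ hW (algebraMap R Γ(Spec R, W) r) =
        algebraMap R (Spec R).functionField r :=
      StructureSheaf.algebraMap_germ_apply W _ hW r
    rw [this]
    exact IsFractionRing.lift_algebraMap hφ r
  have hres : ∀ (W W' : (Spec R).Opens) (h : W' ≤ W) (hW : genericPoint (Spec R) ∈ W') t,
      (Spec R).presheaf.germ W' _ hW ((Spec R).presheaf.map (homOfLE h).op t) =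
        (Spec R).presheaf.germ W _ (h hW) t := fun W W' h hW t =>
    (Spec R).presheaf.germ_res_apply (homOfLE h) _ hW t
  refine ⟨lift.comp ((Spec R).presheaf.germ _ _ hUg).hom,
    lift.injective.comp (germ_injective_of_isIntegral (Spec R) _ hUg), fun r => hgerm _ _ r,
    fun q => ⟨?_, fun hq => ?_⟩⟩
  · rintro ⟨t, rfl⟩ i
    obtain ⟨⟨r, ⟨_, N, rfl⟩⟩, hr⟩ := IsLocalization.surj (Submonoid.powers (s i))
      (S := Γ(Spec R, V i))
      ((Spec R).presheaf.map (homOfLE (hVU i)).op t)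
    refine ⟨N, r, ?_⟩
    have := congrArg (fun z => lift ((Spec R).presheaf.germ _ _ (hgen i) z)) hr
    simp only [map_mul, hgerm, hres, map_pow] at this
    rw [mul_comm, ← this]
    rfl
  · choose N r hr using hq
    have hsec : ∀ i, ∃ t : Γ(Spec R, V i),
        lift ((Spec R).presheaf.germ _ _ (hgen i) t) = q := by
      intro i
      refine ⟨IsLocalization.mk' _ (r i) (⟨s i ^ N i, N i, rfl⟩ : Submonoid.powers (s i)), ?_⟩
      have := congrArg (fun z => lift ((Spec R).presheaf.germ _ _ (hgen i) z))
        (IsLocalization.mk'_spec Γ(Spec R, V i) (r i)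
          (⟨s i ^ N i, N i, rfl⟩ : Submonoid.powers (s i)))
      simp only [map_mul, hgerm, map_pow] at this
      rw [← hr, mul_comm] at this
      exact mul_left_cancel₀ (pow_ne_zero _ ((map_ne_zero_iff φ hφ).2 (hs i))) this
    choose t ht using hsec
    obtain ⟨g, hg, -⟩ := (Spec R).sheaf.existsUnique_gluing'
      V U (fun i => homOfLE (hVU i))
      hUV t (by
        intro i j
        -- The sections agree on overlaps because both have the image q in K.
        have hij : genericPoint (Spec R) ∈ V i ⊓ V j := ⟨hgen i, hgen j⟩
        apply germ_injective_of_isIntegral (Spec R) _ hij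
        apply lift.injective
        refine (congrArg lift (hres _ _ inf_le_left hij (t i))).trans ?_
        refine Eq.trans ?_ (congrArg lift (hres _ _ inf_le_right hij (t j))).symm
        rw [ht, ht])
    refine ⟨g, ?_⟩
    have h0 := hg (Classical.arbitrary ι)
    have h1 := hres _ _ (hVU (Classical.arbitrary ι)) (hgen _) g
    rw [← ht (Classical.arbitrary ι), ← h0]
    exact (congrArg lift h1).symm

/-! ### Formal integration of polynomials in characteristic zero -/

noncomputable section

namespace Polynomial

variable (k : Type*) {R S : Type*} [Field k] [CommRing R] [Algebra k R] [CommRing S] [Algebra k S]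

/-- The antiderivative without constant term of a polynomial over an algebra over a field `k`, which
should be of characteristic zero. -/
def antideriv : R[X] →ₗ[R] R[X] := lsum fun n => ((n : k) + 1)⁻¹ • monomial (n + 1)

theorem antideriv_apply (p : R[X]) :
    antideriv k p = p.sum fun n c => monomial (n + 1) (((n : k) + 1)⁻¹ • c) := by
  simp only [antideriv, lsum, LinearMap.coe_mk, AddHom.coe_mk, LinearMap.smul_apply, smul_monomial]

theorem coeff_zero_antideriv (p : R[X]) : (antideriv k p).coeff 0 = 0 := by
  simp [antideriv_apply, sum_def, coeff_monomial]

theorem coeff_succ_antideriv (p : R[X]) (n : ℕ) :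
    (antideriv k p).coeff (n + 1) = ((n : k) + 1)⁻¹ • p.coeff n := by
  simp only [antideriv_apply, sum_def, finsetSum_coeff, coeff_monomial, add_left_inj]
  rw [Finset.sum_ite_eq']
  split_ifs with h
  · rfl
  · rw [notMem_support_iff.1 h, smul_zero]

theorem eval_zero_antideriv (p : R[X]) : (antideriv k p).eval 0 = 0 := by
  rw [← coeff_zero_eq_eval_zero, coeff_zero_antideriv]

theorem derivative_antideriv [CharZero k] (p : R[X]) : derivative (antideriv k p) = p := by
  ext n
  have h : ((n : k) + 1) ≠ 0 := by exact_mod_cast n.succ_ne_zero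
  have h' : ((n : R) + 1) = algebraMap k R (n + 1) := by simp
  rw [coeff_derivative, coeff_succ_antideriv, h', mul_comm, ← Algebra.smul_def, smul_smul,
    mul_inv_cancel₀ h, one_smul]

theorem eq_C_eval_of_derivative_eq_zero [CharZero k] {p : R[X]} (h : derivative p = 0) :
    p = C (p.eval 0) := by
  rw [← coeff_zero_eq_eval_zero]
  ext n
  cases n with
  | zero => simp
  | succ n =>
    have h0 : ((n : k) + 1) ≠ 0 := by exact_mod_cast n.succ_ne_zero
    have h1 := congrArg (fun q => coeff q n) h
    have h' : ((n : R) + 1) = algebraMap k R (n + 1) := by simp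
    simp only [coeff_derivative, coeff_zero] at h1
    rw [h', mul_comm, ← Algebra.smul_def] at h1
    have h2 := congrArg (fun z => ((n : k) + 1)⁻¹ • z) h1
    simpa [smul_smul, inv_mul_cancel₀ h0] using h2

/-- The difference of p and q has zero derivative and is constant. Substitution in integrals and
integration by parts are all carried out below by this comparison of primitives. -/
theorem eval_sub_eval_eq_of_derivative_eq [CharZero k] {p q : R[X]}
    (h : derivative p = derivative q) (s t : R) :
    p.eval s - p.eval t = q.eval s - q.eval t := by
  have h1 := eq_C_eval_of_derivative_eq_zero k (p := p - q) (by simp [h])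
  have h2 := congrArg (eval s) h1
  have h3 := congrArg (eval t) h1
  simp only [eval_sub, eval_C] at h2 h3
  linear_combination h2 - h3

theorem map_antideriv (g : R →ₐ[k] S) (p : R[X]) :
    (antideriv k p).map (g : R →+* S) = antideriv k (p.map (g : R →+* S)) := by
  ext n
  cases n with
  | zero => simp [coeff_zero_antideriv]
  | succ n => simp [coeff_succ_antideriv]

/-- Chain rule for a derivation that kills the coefficients of `p`. -/
theorem derivation_eval (d : Derivation k R R) {p : R[X]} (hp : ∀ n, d (p.coeff n) = 0) (u : R) :
    d (p.eval u) = (derivative p).eval u * d u := by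
  rw [eval_eq_sum, derivative_eval, sum_def, sum_def, map_sum, Finset.sum_mul]
  refine Finset.sum_congr rfl fun n _ => ?_
  rw [Derivation.leibniz, hp, Derivation.leibniz_pow]
  simp only [smul_eq_mul, nsmul_eq_mul]
  ring

/-- The integral of `X ^ m * (1 - X) ^ n` from `0` to `1` is not zero. -/
theorem eval_one_antideriv_ne_zero [CharZero k] (m n : ℕ) :
    (antideriv k (X ^ m * (1 - X) ^ n : k[X])).eval 1 ≠ 0 := by
  induction n generalizing m with
  | zero =>
    have h : antideriv k (X ^ m : k[X]) = monomial (m + 1) (((m : k) + 1)⁻¹ • 1) := by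
      rw [antideriv_apply, ← monomial_one_right_eq_X_pow, sum_monomial_index _ _ (by simp)]
    have h0 : ((m : k) + 1) ≠ 0 := by exact_mod_cast m.succ_ne_zero
    simpa [h] using h0
  | succ n ih =>
    -- Integration by parts: q vanishes at 0 and 1, so (m + 1) ∫ X^m (1 - X)^(n+1) = (n + 1) ∫
    -- X^(m+1) (1 - X)^n.
    have h := eval_sub_eval_eq_of_derivative_eq k
      (p := ((m : k) + 1) • antideriv k (X ^ m * (1 - X) ^ (n + 1) : k[X]) -
        ((n : k) + 1) • antideriv k (X ^ (m + 1) * (1 - X) ^ n : k[X]))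
      (q := X ^ (m + 1) * (1 - X) ^ (n + 1)) (by
        simp only [derivative_sub, derivative_antideriv, derivative_mul, derivative_pow,
          derivative_one, derivative_X, smul_eq_C_mul]
        simp
        ring) 1 0
    simp only [eval_sub, eval_smul, eval_zero_antideriv] at h
    intro h0
    rw [h0] at h
    have h1 : ((n : k) + 1) ≠ 0 := by exact_mod_cast n.succ_ne_zero
    simp [h1, ih] at h

end Polynomial

/-! ### Orbits of the additive group action -/

namespace SevenDim

open Polynomial

variable {k : Type*} [Field k] (a b : ℕ) {R S : Type*} [CommRing R] [Algebra k R] [CommRing S]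
  [Algebra k S]

theorem D_x (i : Fin 3) : D k a b (x k i) = 0 := by
  simp [D, x, MvPolynomial.pderiv_X, Fin.sum_univ_three]

theorem D_y (i : Fin 3) : D k a b (y k i) = x k i ^ a := by
  fin_cases i <;> simp [D, y, MvPolynomial.pderiv_X, Fin.sum_univ_three]

theorem D_v : D k a b (v k) = (y k 0 * y k 1 * y k 2) ^ b := by
  simp [D, v, MvPolynomial.pderiv_X, Fin.sum_univ_three]

theorem induction_on {P : B k → Prop} (f : B k) (hC : ∀ c, P (MvPolynomial.C c))
    (hadd : ∀ f g, P f → P g → P (f + g)) (hmul : ∀ f g, P f → P g → P (f * g))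
    (hx : ∀ i, P (x k i)) (hy : ∀ i, P (y k i)) (hv : P (v k)) : P f :=
  MvPolynomial.induction_on f hC hadd fun f n hf => hmul f _ hf <| match n with
    | Sum.inl i => hx i
    | Sum.inr (Sum.inl i) => hy i
    | Sum.inr (Sum.inr ()) => hv

/-- The point with given coordinates. -/
def point (ξ η : Fin 3 → R) (ν : R) : Vars → R := Sum.elim ξ (Sum.elim η fun _ => ν)

@[simp] theorem aeval_point_x (ξ η : Fin 3 → R) (ν : R) (i : Fin 3) :
    MvPolynomial.aeval (point ξ η ν) (x k i) = ξ i := by simp [point, x]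

@[simp] theorem aeval_point_y (ξ η : Fin 3 → R) (ν : R) (i : Fin 3) :
    MvPolynomial.aeval (point ξ η ν) (y k i) = η i := by simp [point, y]

@[simp] theorem aeval_point_v (ξ η : Fin 3 → R) (ν : R) :
    MvPolynomial.aeval (point ξ η ν) (v k) = ν := by simp [point, v]

/-- The polynomial `∏ⱼ (ηⱼ + ξⱼ^a T)^b`. -/
def speed (ξ η : Fin 3 → R) : R[X] := ∏ j, (C (η j) + C (ξ j) ^ a * X) ^ b

variable (k) in
/-- The restriction of polynomials to the orbit of a point under the action of the additive group
that corresponds to `D`. -/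
def flow (ξ η : Fin 3 → R) (ν : R) : B k →ₐ[k] R[X] :=
  MvPolynomial.aeval (point (fun i => C (ξ i)) (fun i => C (η i) + C (ξ i) ^ a * X)
    (C ν + antideriv k (speed a b ξ η)))

variable (ξ η : Fin 3 → R) (ν : R)

@[simp] theorem flow_x (i : Fin 3) : flow k a b ξ η ν (x k i) = C (ξ i) := aeval_point_x ..

@[simp] theorem flow_y (i : Fin 3) :
    flow k a b ξ η ν (y k i) = C (η i) + C (ξ i) ^ a * X := aeval_point_y ..

@[simp] theorem flow_v :
    flow k a b ξ η ν (v k) = C ν + antideriv k (speed a b ξ η) := aeval_point_v ..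

/-- The curve solves the differential equation defined by `D`. Both sides obey the same product rule
in f, so the generators suffice. -/
theorem derivative_flow [CharZero k] (f : B k) :
    derivative (flow k a b ξ η ν f) = flow k a b ξ η ν (D k a b f) := by
  induction f using induction_on with
  | hC c => simp
  | hadd f g hf hg => simp [hf, hg]
  | hmul f g hf hg => simp [hf, hg]; ring
  | hx i => simp [D_x]
  | hy i => simp [D_y, derivative_pow]
  | hv => simp [D_v, derivative_antideriv, speed, Fin.prod_univ_three, mul_pow]

theorem eval_flow (t : R) (f : B k) :
    (flow k a b ξ η ν f).eval t = MvPolynomial.aeval (point ξ (fun i => η i + ξ i ^ a * t)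
      (ν + (antideriv k (speed a b ξ η)).eval t)) f := by
  induction f using induction_on with
  | hC c => simp
  | hadd f g hf hg => simp [hf, hg]
  | hmul f g hf hg => simp [hf, hg]
  | hx i => simp
  | hy i => simp
  | hv => simp

theorem eval_zero_flow (f : B k) :
    (flow k a b ξ η ν f).eval 0 = MvPolynomial.aeval (point ξ η ν) f := by
  simp [eval_flow, eval_zero_antideriv]

theorem map_speed (g : R →+* S) :
    (speed a b ξ η).map g = speed a b (fun i => g (ξ i)) (fun i => g (η i)) := by
  simp [speed, Polynomial.map_prod]

theorem map_flow (g : R →ₐ[k] S) (f : B k) :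
    (flow k a b ξ η ν f).map (g : R →+* S) =
      flow k a b (fun i => g (ξ i)) (fun i => g (η i)) (g ν) f := by
  induction f using induction_on with
  | hC c => simp
  | hadd f g hf hg => simp [hf, hg]
  | hmul f g hf hg => simp [hf, hg]
  | hx i => simp
  | hy i => simp
  | hv => simp [map_antideriv, map_speed]

/-- Invariants are constant on orbits. -/
theorem flow_eq_C [CharZero k] {f : B k} (hf : D k a b f = 0) :
    flow k a b ξ η ν f = C (MvPolynomial.aeval (point ξ η ν) f) := by
  rw [← eval_zero_flow a b]
  exact eq_C_eval_of_derivative_eq_zero k (by rw [derivative_flow, hf, map_zero])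

theorem aeval_generic_point (f : B k) :
    MvPolynomial.aeval (point (x k) (y k) (v k)) f = f := by
  conv_rhs => rw [← MvPolynomial.aeval_X_left_apply f]
  congr 2
  funext n
  rcases n with i | i | u <;> rfl

theorem iterate_derivative_flow [CharZero k] (f : B k) (n : ℕ) :
    derivative^[n] (flow k a b ξ η ν f) = flow k a b ξ η ν ((D k a b)^[n] f) := by
  induction n with
  | zero => rfl
  | succ n ih => rw [Function.iterate_succ_apply', ih, derivative_flow, Function.iterate_succ_apply']

/-- This is Taylor's formula at T = 0, where the flow of the generic point is the identity. It
identifies the explicit curve with θ. -/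
theorem coeff_flow_generic [CharZero k] (f : B k) (n : ℕ) :
    (flow k a b (x k) (y k) (v k) f).coeff n = (Nat.factorial n : k)⁻¹ • (D k a b)^[n] f := by
  have h := congrArg (eval 0) (iterate_derivative_flow a b (x k) (y k) (v k) f n)
  rw [eval_zero_flow, aeval_generic_point, ← coeff_zero_eq_eval_zero, coeff_iterate_derivative,
    zero_add, Nat.descFactorial_self] at h
  have h0 : (Nat.factorial n : k) ≠ 0 := by exact_mod_cast n.factorial_ne_zero
  rw [← h, ← Nat.cast_smul_eq_nsmul k, smul_smul, inv_mul_cancel₀ h0, one_smul]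

theorem isLND_D [CharZero k] : IsLND (D k a b) := by
  intro f
  let p := flow k a b (x k) (y k) (v k) f
  refine ⟨p.natDegree + 1, ?_⟩
  have h := coeff_flow_generic a b f (p.natDegree + 1)
  rw [coeff_eq_zero_of_natDegree_lt (Nat.lt_succ_self _)] at h
  have h0 : (Nat.factorial (p.natDegree + 1) : k) ≠ 0 := by
    exact_mod_cast (p.natDegree + 1).factorial_ne_zero
  exact (smul_eq_zero.1 h.symm).resolve_left (inv_ne_zero h0)

theorem theta_eq_flow [CharZero k] (f : B k) :
    (D k a b).theta f = flow k a b (x k) (y k) (v k) f := by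
  simp only [Derivation.theta, ← coeff_flow_generic a b f]
  rw [finsum_eq_sum_of_support_subset (s := (flow k a b (x k) (y k) (v k) f).support),
    ← as_sum_support]
  intro n hn
  simpa using hn

end SevenDim

/-! ### Invariants on the linear space x = 0 -/

namespace SevenDim

open Polynomial

variable {k : Type*} [Field k] [CharZero k] (a b : ℕ)

/-- An invariant takes the same value at two points with `x = 0` that are connected by a line along
which the integral of `(y₁y₂y₃)^b` is zero. -/
theorem aeval_add_eq_of_integral_eq_zero [IsAlgClosed k] (ha : 1 ≤ a) {f : B k}
    (hf : D k a b f = 0) (η ω : Fin 3 → k) (ν : k)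
    (h : (antideriv k (∏ j, (C (η j) + C (ω j) * X) ^ b)).eval 1 = 0) :
    MvPolynomial.aeval (point 0 (η + ω) ν) f = MvPolynomial.aeval (point 0 η ν) f := by
  choose ξ hξ using fun i => IsAlgClosed.exists_pow_nat_eq (ω i) (n := a) ha
  have key : ∀ ε : k, ε ≠ 0 → MvPolynomial.aeval (point (fun i => ξ i * ε) (η + ω) ν) f =
      MvPolynomial.aeval (point (fun i => ξ i * ε) η ν) f := by
    intro ε hε
    have hεa : ε ^ a ≠ 0 := pow_ne_zero _ hε
    have h1 := congrArg (eval (ε ^ a)⁻¹) (flow_eq_C a b (fun i => ξ i * ε) η ν hf)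
    have h2 : (antideriv k (speed a b (fun i => ξ i * ε) η)).eval (ε ^ a)⁻¹ = 0 := by
      -- The substitution s = ε^a T turns ε^a times the integral of the speed from 0 to ε^(-a) into
      -- the integral from 0 to 1 that vanishes by hypothesis.
      have h3 := eval_sub_eval_eq_of_derivative_eq k
        (p := C (ε ^ a) * antideriv k (speed a b (fun i => ξ i * ε) η))
        (q := (antideriv k (∏ j, (C (η j) + C (ω j) * X) ^ b)).comp (C (ε ^ a) * X)) (by
          rw [derivative_C_mul, derivative_comp, derivative_antideriv, derivative_antideriv, speed,
            prod_comp]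
          simp [mul_pow, mul_assoc, ← hξ, derivative_pow]) (ε ^ a)⁻¹ 0
      simpa [eval_zero_antideriv, hεa, h, hε] using h3
    rw [eval_flow, h2, add_zero, eval_C] at h1
    rw [← h1]
    congr 3
    funext i
    simp [mul_pow, hξ, hεa]
  have hp : ∀ (η : Fin 3 → k) (ε : k), MvPolynomial.aeval (point (fun i => ξ i * ε) η ν) f =
      (MvPolynomial.aeval (point (fun i => C (ξ i) * X) (fun i => C (η i)) (C ν)) f : k[X]).eval ε := by
    intro η ε
    generalize f = g
    induction g using induction_on with
    | hC c => simp
    | hadd f g hf hg => simp only [map_add, eval_add, hf, hg]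
    | hmul f g hf hg => simp only [map_mul, eval_mul, hf, hg]
    | hx i => simp
    | hy i => simp
    | hv => simp
  simp only [hp] at key
  -- Both sides are polynomials in ε that agree for all ε ≠ 0, hence also at ε = 0.
  have h0 := eq_of_infinite_eval_eq _ _ 
    ((Set.finite_singleton (0 : k)).infinite_compl.mono fun ε hε => key ε hε)
  have h1 := hp (η + ω) 0
  have h2 := hp η 0
  rw [h0, ← h2] at h1
  simpa [← Pi.zero_def] using h1

/-- For given `z` there is `c` such that the integral of `s^(2b) (c (1 - s) + z s)^b` from `0` to `1`
is zero. -/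
theorem exists_integral_eq_zero [IsAlgClosed k] (hb : 1 ≤ b) (z : k) :
    ∃ c : k, (antideriv k (X ^ (2 * b) * (C c * (1 - X) + C z * X) ^ b : k[X])).eval 1 = 0 := by
  let β : ℕ → k := fun j => (antideriv k (X ^ (3 * b - j) * (1 - X) ^ j : k[X])).eval 1
  -- The integral as a polynomial in c, by the binomial theorem. The coefficient of c^b is the beta
  -- integral `β b` ≠ 0, so the degree is positive and there is a root.
  let q : k[X] := ∑ j ∈ Finset.range (b + 1), C (z ^ (b - j) * b.choose j * β j) * X ^ j
  have hq : q.coeff b ≠ 0 := by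
    have : q.coeff b = β b := by
      simp only [q, finsetSum_coeff, coeff_C_mul, coeff_X_pow, mul_ite, mul_one, mul_zero]
      simp
    rw [this]
    exact eval_one_antideriv_ne_zero k _ _
  obtain ⟨c, hc⟩ := IsAlgClosed.exists_root q (fun h0 => by
    have := le_degree_of_ne_zero hq
    rw [h0] at this
    have : b ≤ 0 := by exact_mod_cast this
    omega)
  refine ⟨c, ?_⟩
  rw [IsRoot.def, eval_finsetSum] at hc
  rw [← hc, add_pow, Finset.mul_sum, map_sum, eval_finsetSum]
  refine Finset.sum_congr rfl fun j hj => ?_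
  have hj : j ≤ b := by simpa [Nat.lt_succ_iff] using hj
  have : (X ^ (2 * b) * ((C c * (1 - X)) ^ j * (C z * X) ^ (b - j) * (b.choose j : k[X])) : k[X]) =
      (z ^ (b - j) * b.choose j * c ^ j) • (X ^ (3 * b - j) * (1 - X) ^ j) := by
    rw [show 3 * b - j = 2 * b + (b - j) by omega, smul_eq_C_mul]
    simp only [mul_pow, C_mul, C_pow, pow_add, C_eq_natCast]
    ring
  rw [this, map_smul, eval_smul]
  simp [β]
  ring

theorem aeval_point_zero_eq [IsAlgClosed k] (ha : 1 ≤ a) (hb : 1 ≤ b) {f : B k}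
    (hf : D k a b f = 0) (η : Fin 3 → k) (ν : k) :
    MvPolynomial.aeval (point 0 η ν) f = MvPolynomial.aeval (point 0 0 ν) f := by
  have hprod : ∀ η : Fin 3 → k, η 0 = 0 →
      MvPolynomial.aeval (point 0 η ν) f = MvPolynomial.aeval (point 0 0 ν) f := by
    intro η h0
    -- On the segment from 0 to η the first factor of the integrand is identically zero.
    simpa using aeval_add_eq_of_integral_eq_zero a b ha hf 0 η ν (by
      have : b ≠ 0 := by omega
      simp [Fin.prod_univ_three, h0, this])
  -- On the segment from (0, c, 0) to η the integrand is (η₀η₂)^b s^(2b) (c(1 - s) + η₁ s)^b. The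
  -- starting point has first coordinate zero and is covered by `hprod`.
  obtain ⟨c, hc⟩ := exists_integral_eq_zero b hb (η 1)
  rw [← hprod ![0, c, 0] rfl]
  have := aeval_add_eq_of_integral_eq_zero a b ha hf ![0, c, 0] (η - ![0, c, 0]) ν (by
    have : ∏ j, (C ((![0, c, 0] : Fin 3 → k) j) + C ((η - ![0, c, 0]) j) * X) ^ b =
        ((η 0 * η 2) ^ b) • (X ^ (2 * b) * (C c * (1 - X) + C (η 1) * X) ^ b : k[X]) := by
      simp [Fin.prod_univ_three, smul_eq_C_mul]
      ring
    rw [this, map_smul, eval_smul, hc, smul_zero])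
  rwa [add_sub_cancel] at this

/-- Invariants are constant on the linear space `x = 0`. -/
theorem aeval_point_eq_aeval_origin [IsAlgClosed k] (ha : 1 ≤ a) (hb : 1 ≤ b) {f : B k}
    (hf : D k a b f = 0) (η : Fin 3 → k) (ν : k) :
    MvPolynomial.aeval (point 0 η ν) f = MvPolynomial.aeval (point 0 0 0) f := by
  -- Replace y by (1, 1, 1). There, with x = 0, the speed is 1 and y stays fixed because a ≥ 1, so
  -- the flow for time ν moves v from 0 to ν.
  rw [aeval_point_zero_eq a b ha hb hf, ← aeval_point_zero_eq a b ha hb hf 1 0,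
    ← aeval_point_zero_eq a b ha hb hf 1 ν]
  have h := congrArg (eval ν) (flow_eq_C a b 0 1 0 hf)
  have h1 : (antideriv k (speed a b (0 : Fin 3 → k) 1)).eval ν = ν := by
    have := eval_sub_eval_eq_of_derivative_eq k (p := antideriv k (speed a b (0 : Fin 3 → k) 1))
      (q := X) (by
        have : a ≠ 0 := by omega
        simp [derivative_antideriv, speed, this]) ν 0
    simpa [eval_zero_antideriv] using this
  rw [eval_flow, h1, eval_C, zero_add] at h
  rw [← h]
  congr 3
  funext i
  have : a ≠ 0 := by omega
  simp [this]

theorem sub_C_mem_xIdeal [IsAlgClosed k] (ha : 1 ≤ a) (hb : 1 ≤ b) {f : B k}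
    (hf : D k a b f = 0) :
    f - MvPolynomial.C (MvPolynomial.aeval (point 0 0 0) f) ∈ xIdeal k := by
  -- Setting x = 0 in f yields a constant polynomial, since its values are constant and k is
  -- infinite.
  have h1 : (MvPolynomial.aeval (point 0 (y k) (v k)) f : B k) =
      MvPolynomial.C (MvPolynomial.aeval (point 0 0 0) f) := by
    apply MvPolynomial.funext
    intro p
    rw [MvPolynomial.eval_C, ← aeval_point_eq_aeval_origin a b ha hb hf
      (fun i => p (Sum.inr (Sum.inl i))) (p (Sum.inr (Sum.inr ())))]
    generalize f = g
    induction g using induction_on with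
    | hC c => simp
    | hadd f g hf hg => simp only [map_add, hf, hg]
    | hmul f g hf hg => simp only [map_mul, hf, hg]
    | hx i => rw [aeval_point_x, aeval_point_x]; simp
    | hy i => rw [aeval_point_y, aeval_point_y]; simp [y]
    | hv => rw [aeval_point_v, aeval_point_v]; simp [v]
  rw [← h1, ← Ideal.Quotient.mk_eq_mk_iff_sub_mem]
  generalize f = g
  induction g using induction_on with
  | hC c => simp
  | hadd f g hf hg => simp only [map_add, ← hf, ← hg]
  | hmul f g hf hg => simp only [map_mul, ← hf, ← hg]
  | hx i =>
    rw [aeval_point_x, Pi.zero_apply, map_zero, Ideal.Quotient.eq_zero_iff_mem]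
    exact Ideal.subset_span ⟨i, rfl⟩
  | hy i => rw [aeval_point_y]
  | hv => rw [aeval_point_v]

theorem disjoint_one_xIdeal {k : Type*} [Field k] :
    Disjoint (1 : Submodule k (B k)) ((xIdeal k).restrictScalars k) := by
  rw [Submodule.disjoint_def]
  intro f h1 h2
  obtain ⟨c, rfl⟩ := Submodule.mem_one.1 h1
  have h3 : xIdeal k ≤ RingHom.ker (MvPolynomial.constantCoeff : B k →+* k) := by
    rw [xIdeal, Ideal.span_le]
    rintro _ ⟨i, rfl⟩
    simp [x]
  have h4 : MvPolynomial.constantCoeff (algebraMap k (B k) c) = 0 := h3 h2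
  rw [MvPolynomial.algebraMap_eq, MvPolynomial.constantCoeff_C] at h4
  rw [h4, map_zero]

theorem kernel_le_one_sup_xIdeal [IsAlgClosed k] (ha : 1 ≤ a) (hb : 1 ≤ b) :
    Subalgebra.toSubmodule (D k a b).kernel ≤
      (1 : Submodule k (B k)) ⊔ (xIdeal k).restrictScalars k := by
  intro f hf
  rw [Submodule.mem_sup]
  exact ⟨_, Submodule.mem_one.2 ⟨MvPolynomial.aeval (point 0 0 0) f, rfl⟩, _,
    sub_C_mem_xIdeal a b ha hb hf, by rw [MvPolynomial.algebraMap_eq]; ring⟩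

end SevenDim

/-! ### The invariants hᵢ and the slices yᵢ = 0 -/

namespace SevenDim

open Polynomial

variable {k : Type*} [Field k] (a b : ℕ)

variable (k) in
/-- The polynomial `W^b ∏_{j ≠ i} (fᵢⱼ + xⱼ^a W)^b`, where `fᵢⱼ = xᵢ^a yⱼ - xⱼ^a yᵢ`. -/
def slicePoly (i : Fin 3) : (B k)[X] :=
  X ^ b * ∏ j ∈ Finset.univ.erase i,
    (C (x k i ^ a * y k j - x k j ^ a * y k i) + C (x k j ^ a) * X) ^ b

variable (k) in
/-- The polynomial `xᵢ^((2b+1)a) θ(v)|_{T = -yᵢ/xᵢ^a}`. -/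
def hPoly (i : Fin 3) : B k :=
  x k i ^ ((2 * b + 1) * a) * v k - (antideriv k (slicePoly k a b i)).eval (y k i)

theorem D_cross (i j : Fin 3) : D k a b (x k i ^ a * y k j - x k j ^ a * y k i) = 0 := by
  simp [D_x, D_y]
  ring

theorem D_coeff_slicePoly (i : Fin 3) (n : ℕ) : D k a b ((slicePoly k a b i).coeff n) = 0 := by
  have hC : ∀ f, D k a b f = 0 → C f ∈ lifts (algebraMap (D k a b).kernel (B k)) := fun f hf =>
    C_mem_lifts (algebraMap (D k a b).kernel (B k)) ⟨f, hf⟩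
  have h : slicePoly k a b i ∈ lifts (algebraMap (D k a b).kernel (B k)) := by
    refine mul_mem (pow_mem (X_mem_lifts _) _) (prod_mem fun j _ => pow_mem (add_mem ?_ ?_) _)
    · exact hC _ (D_cross a b i j)
    · exact mul_mem (hC _ (by simp [D_x])) (X_mem_lifts _)
  obtain ⟨c, hc⟩ := (lifts_iff_coeff_lifts _).1 h n
  rw [← hc]
  exact c.2

/-- At W = yᵢ each factor fᵢⱼ + xⱼ^a W collapses to xᵢ^a yⱼ. -/
theorem eval_slicePoly (i : Fin 3) : (slicePoly k a b i).eval (y k i) * x k i ^ a =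
    x k i ^ ((2 * b + 1) * a) * (y k 0 * y k 1 * y k 2) ^ b := by
  have h : (slicePoly k a b i).eval (y k i) =
      x k i ^ (2 * (a * b)) * ∏ j, y k j ^ b := by
    simp only [slicePoly, eval_mul, eval_prod, eval_pow, eval_X, eval_add, eval_C,
      sub_add_cancel, mul_pow, Finset.prod_mul_distrib, Finset.prod_const]
    rw [← Finset.mul_prod_erase Finset.univ (fun j => y k j ^ b) (Finset.mem_univ i)]
    simp
    ring
  rw [h, Fin.prod_univ_three]
  ring

/-- The coefficients of `slicePoly` are invariant, so the chain rule differentiates its primitive at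
yᵢ to `slicePoly` at yᵢ times xᵢ^a, which cancels xᵢ^((2b+1)a) D(v). -/
theorem D_hPoly [CharZero k] (i : Fin 3) : D k a b (hPoly k a b i) = 0 := by
  have h := derivation_eval k (D k a b) (p := antideriv k (slicePoly k a b i)) (fun n => by
    cases n with
    | zero => rw [coeff_zero_antideriv, map_zero]
    | succ n => rw [coeff_succ_antideriv, Derivation.map_smul, D_coeff_slicePoly, smul_zero]) (y k i)
  rw [derivative_antideriv, D_y, eval_slicePoly] at h
  rw [hPoly, map_sub, h]
  simp [D_x, D_v]

variable (k) in
/-- The value of the parameter `T` at which the orbit of the generic point meets `yᵢ = 0`. -/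
def sliceTime (i : Fin 3) : FractionRing (B k) :=
  -(algebraMap (B k) (FractionRing (B k)) (y k i)) /
    algebraMap (B k) (FractionRing (B k)) (x k i) ^ a

variable (k) in
/-- The restriction of polynomials to the orbit of the generic point. -/
def genericFlow : B k →ₐ[k] (FractionRing (B k))[X] :=
  flow k a b (fun i => algebraMap (B k) (FractionRing (B k)) (x k i))
    (fun i => algebraMap (B k) (FractionRing (B k)) (y k i))
    (algebraMap (B k) (FractionRing (B k)) (v k))

theorem algebraMap_x_ne_zero (i : Fin 3) :
    algebraMap (B k) (FractionRing (B k)) (x k i) ≠ 0 := by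
  simp [x]

theorem hFrac_eq [CharZero k] (i : Fin 3) :
    hFrac k a b i = algebraMap (B k) (FractionRing (B k)) (x k i) ^ ((2 * b + 1) * a) *
      (genericFlow k a b (v k)).eval (sliceTime k a i) := by
  rw [hFrac, theta_eq_flow, genericFlow, ← eval_map_algebraMap]
  have := map_flow a b (x k) (y k) (v k) (IsScalarTower.toAlgHom k (B k) (FractionRing (B k))) (v k)
  exact congrArg (fun p => _ * eval _ p) this

theorem eval_sliceTime_x (i j : Fin 3) : (genericFlow k a b (x k j)).eval (sliceTime k a i) =
    algebraMap (B k) (FractionRing (B k)) (x k j) := by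
  simp [genericFlow]

theorem eval_sliceTime_y (i j : Fin 3) :
    algebraMap (B k) (FractionRing (B k)) (x k i) ^ a *
      (genericFlow k a b (y k j)).eval (sliceTime k a i) =
    algebraMap (B k) (FractionRing (B k)) (x k i ^ a * y k j - x k j ^ a * y k i) := by
  have := algebraMap_x_ne_zero (k := k) i
  simp [genericFlow, sliceTime]
  field_simp
  ring

/-- Substitute T = (W - yᵢ)/xᵢ^a in the integral of the speed. The exponent (2b+1)a is what clears
denominators: dT contributes xᵢ^(-a), and each of the two factors with j ≠ i needs xᵢ^(ab). -/
theorem algebraMap_hPoly [CharZero k] (i : Fin 3) :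
    algebraMap (B k) (FractionRing (B k)) (hPoly k a b i) = hFrac k a b i := by
  rw [hFrac_eq, genericFlow, flow_v, hPoly, map_sub, map_mul, map_pow, eval_add, eval_C, mul_add,
    sub_eq_add_neg, add_right_inj]
  have hx := algebraMap_x_ne_zero (k := k) i
  have hmap := map_antideriv k (IsScalarTower.toAlgHom k (B k) (FractionRing (B k)))
    (slicePoly k a b i)
  have hev : algebraMap (B k) (FractionRing (B k))
      ((antideriv k (slicePoly k a b i)).eval (y k i)) =
      (antideriv k ((slicePoly k a b i).map (algebraMap (B k) (FractionRing (B k))))).eval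
        (algebraMap (B k) (FractionRing (B k)) (y k i)) := by
    rw [← eval_map_apply]
    exact congrArg (eval _) hmap
  rw [hev]
  set ι := algebraMap (B k) (FractionRing (B k)) with hι
  set ξ := ι (x k i) with hξ
  have hL : C (ξ ^ a) * (C (ξ ^ a)⁻¹ * (X - C (ι (y k i)))) = X - C (ι (y k i)) := by
    rw [← mul_assoc, ← C_mul, mul_inv_cancel₀ (pow_ne_zero _ hx), C_1, one_mul]
  have hL' : derivative (C (ξ ^ a)⁻¹ * (X - C (ι (y k i)))) = C (ξ ^ a)⁻¹ := by
    rw [derivative_C_mul, derivative_sub, derivative_X, derivative_C, sub_zero, mul_one]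
  have key := eval_sub_eval_eq_of_derivative_eq k
    (p := C (ξ ^ ((2 * b + 1) * a)) *
      (antideriv k (speed a b (fun i => ι (x k i)) (fun i => ι (y k i)))).comp
        (C (ξ ^ a)⁻¹ * (X - C (ι (y k i)))))
    (q := antideriv k ((slicePoly k a b i).map ι)) (by
      rw [derivative_C_mul, derivative_comp, derivative_antideriv, derivative_antideriv, speed,
        ← Finset.mul_prod_erase Finset.univ _ (Finset.mem_univ i), mul_comp, prod_comp, slicePoly,
        hL']
      generalize C (ξ ^ a)⁻¹ * (X - C (ι (y k i))) = L at hL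
      have hi : ((C (ι (y k i)) + C ξ ^ a * X) ^ b).comp L = X ^ b := by
        simp only [pow_comp, add_comp, mul_comp, C_comp, X_comp, ← C_pow, hL, add_sub_cancel]
      have hj : ∀ j, Polynomial.map ι ((C (x k i ^ a * y k j - x k j ^ a * y k i) +
          C (x k j ^ a) * X) ^ b) =
          C (ξ ^ (a * b)) * ((C (ι (y k j)) + C (ι (x k j)) ^ a * X) ^ b).comp L := by
        intro j
        rw [pow_mul, C_pow (a := ξ ^ a), pow_comp, ← mul_pow, Polynomial.map_pow]
        congr 1
        simp only [add_comp, mul_comp, C_comp, X_comp, pow_comp, Polynomial.map_add,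
          Polynomial.map_mul, Polynomial.map_sub, Polynomial.map_pow, map_C, map_X, C_sub, C_mul,
          C_pow, ← hξ]
        rw [C_pow] at hL
        linear_combination (-C (ι (x k j)) ^ a) * hL
      rw [Polynomial.map_mul, Polynomial.map_pow, map_X, Polynomial.map_prod,
        Finset.prod_congr rfl fun j _ => hj j, Finset.prod_mul_distrib, Finset.prod_const, hi]
      have hc : C (ξ ^ ((2 * b + 1) * a)) * C (ξ ^ a)⁻¹ = C (ξ ^ (a * b)) ^ 2 := by
        rw [← C_mul, ← C_pow]
        congr 1
        field_simp
        ring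
      rw [Finset.card_erase_of_mem (Finset.mem_univ i)]
      simp only [Finset.card_univ, Fintype.card_fin, Nat.add_one_sub_one]
      rw [← mul_assoc, hc]
      ring) 0 (ι (y k i))
  -- The limits W = 0 and W = yᵢ correspond to T = -yᵢ/xᵢ^a and T = 0, and each primitive vanishes
  -- at 0.
  simp only [eval_mul, eval_C, eval_comp, eval_sub, eval_X, sub_self, mul_zero, zero_sub,
    eval_zero_antideriv, sub_zero] at key
  rw [← key, sliceTime, div_eq_inv_mul]

end SevenDim

/-! ### Comparison of A with the ring of invariants -/

namespace SevenDim

open Polynomial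

variable {k : Type*} [Field k] (a b : ℕ)

theorem x_mem_A (h : Fin 3 → B k) (i : Fin 3) : x k i ∈ A k a h := by
  apply Algebra.subset_adjoin
  fin_cases i <;> simp

theorem h_mem_A (h : Fin 3 → B k) (i : Fin 3) : h i ∈ A k a h := by
  apply Algebra.subset_adjoin
  fin_cases i <;> simp

theorem cross_mem_A (h : Fin 3 → B k) (i j : Fin 3) :
    x k i ^ a * y k j - x k j ^ a * y k i ∈ A k a h := by
  have hlt : ∀ i j : Fin 3, i < j → x k i ^ a * y k j - x k j ^ a * y k i ∈ A k a h := by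
    intro i j hij
    apply Algebra.subset_adjoin
    fin_cases i <;> fin_cases j <;> simp at hij ⊢
  rcases lt_trichotomy i j with hij | rfl | hij
  · exact hlt i j hij
  · simp
  · rw [← neg_sub]
    exact neg_mem (hlt j i hij)

theorem xIdealA_eq (h : Fin 3 → B k) :
    xIdealA k a h = Ideal.span (Set.range fun i => (⟨x k i, x_mem_A a h i⟩ : A k a h)) := by
  rw [xIdealA]
  congr 1
  ext g
  simp only [Set.mem_ofPred_eq, Set.mem_range, Subtype.ext_iff, eq_comm]

variable [CharZero k]

theorem A_le_kernel : A k a (hPoly k a b) ≤ (D k a b).kernel := by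
  rw [A, Algebra.adjoin_le_iff]
  rintro f (rfl | rfl | rfl | rfl | rfl | rfl | rfl | rfl | rfl)
  exacts [D_x a b _, D_x a b _, D_x a b _, D_cross a b _ _, D_cross a b _ _, D_cross a b _ _,
    D_hPoly a b _, D_hPoly a b _, D_hPoly a b _]

/-- After multiplication by a power of `xᵢ` an invariant lies in `A`. -/
theorem exists_pow_mul_mem_A {f : B k} (hf : D k a b f = 0) (i : Fin 3) :
    ∃ N : ℕ, x k i ^ N * f ∈ A k a (hPoly k a b) := by
  -- No invariance is needed here: the condition is stable under sums and products, and for yⱼ and v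
  -- the values on the slice are fᵢⱼ/xᵢ^a and hᵢ/xᵢ^((2b+1)a).
  have key : ∀ g : B k, ∃ N : ℕ, ∃ c ∈ A k a (hPoly k a b),
      algebraMap (B k) (FractionRing (B k)) (x k i) ^ N *
        (genericFlow k a b g).eval (sliceTime k a i) =
      algebraMap (B k) (FractionRing (B k)) c := by
    intro g
    induction g using induction_on with
    | hC c =>
      refine ⟨0, algebraMap k _ c, Subalgebra.algebraMap_mem _ _, ?_⟩
      rw [← MvPolynomial.algebraMap_eq, AlgHom.commutes, ← IsScalarTower.algebraMap_apply]
      simp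
    | hadd f g hf hg =>
      obtain ⟨m, c, hc, h1⟩ := hf
      obtain ⟨n, d, hd, h2⟩ := hg
      refine ⟨m + n, x k i ^ n * c + x k i ^ m * d,
        add_mem (mul_mem (pow_mem (x_mem_A a _ i) _) hc)
          (mul_mem (pow_mem (x_mem_A a _ i) _) hd), ?_⟩
      simp only [map_add, map_mul, map_pow, ← h1, ← h2, eval_add]
      ring
    | hmul f g hf hg =>
      obtain ⟨m, c, hc, h1⟩ := hf
      obtain ⟨n, d, hd, h2⟩ := hg
      refine ⟨m + n, c * d, mul_mem hc hd, ?_⟩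
      simp only [map_mul, ← h1, ← h2, eval_mul]
      ring
    | hx j => exact ⟨0, x k j, x_mem_A a _ j, by rw [eval_sliceTime_x, pow_zero, one_mul]⟩
    | hy j => exact ⟨a, _, cross_mem_A a _ i j, eval_sliceTime_y a b i j⟩
    | hv => exact ⟨_, _, h_mem_A a _ i, by rw [algebraMap_hPoly, hFrac_eq]⟩
  obtain ⟨N, c, hc, h⟩ := key f
  refine ⟨N, ?_⟩
  -- An invariant is constant on the generic orbit, so its value on the slice is f itself.
  have h1 : (genericFlow k a b f).eval (sliceTime k a i) =
      algebraMap (B k) (FractionRing (B k)) f := by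
    rw [genericFlow, flow_eq_C a b _ _ _ hf, eval_C]
    have := MvPolynomial.aeval_algebraMap_apply (FractionRing (B k)) (point (x k) (y k) (v k)) f
    rw [aeval_generic_point] at this
    rw [← this]
    congr 2
    funext n
    rcases n with i | i | u <;> rfl
  rw [h1, ← map_pow, ← map_mul] at h
  rwa [IsFractionRing.injective (B k) (FractionRing (B k)) h]

theorem isSeparatingAlgebra [IsAlgClosed k] (ha : 1 ≤ a) (hb : 1 ≤ b) :
    IsSeparatingAlgebra (A k a (hPoly k a b)) (D k a b).kernel := by
  refine ⟨A_le_kernel a b, ?_⟩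
  rintro p q ⟨f, hf, hpq⟩
  by_contra! hA
  refine hpq ?_
  have hx : ∀ i, p (Sum.inl i) = q (Sum.inl i) := fun i => by
    simpa [x] using hA _ (x_mem_A a _ i)
  by_cases h0 : ∃ i, p (Sum.inl i) ≠ 0
  · obtain ⟨i, hi⟩ := h0
    obtain ⟨N, hN⟩ := exists_pow_mul_mem_A a b hf i
    have := hA _ hN
    simp only [map_mul, map_pow, x, MvPolynomial.eval_X, ← hx] at this
    exact mul_left_cancel₀ (pow_ne_zero _ hi) this
  · push Not at h0
    have hval : ∀ p : Vars → k, (∀ i, p (Sum.inl i) = 0) →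
        MvPolynomial.eval p f = MvPolynomial.aeval (point 0 0 0) f := by
      intro p hp
      rw [← aeval_point_eq_aeval_origin a b ha hb hf (fun i => p (Sum.inr (Sum.inl i)))
        (p (Sum.inr (Sum.inr ()))), MvPolynomial.aeval_eq_eval]
      congr 2
      funext n
      rcases n with i | i | u
      exacts [hp i, rfl, rfl]
    rw [hval p h0, hval q fun i => (hx i).symm.trans (h0 i)]

/-- Invariants are the fractions that lie in `A` after multiplication by powers of each `xᵢ`. -/
theorem mem_image_kernel_iff (q : FractionRing (B k)) :
    q ∈ algebraMap (B k) (FractionRing (B k)) '' ((D k a b).kernel : Set (B k)) ↔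
      ∀ i, ∃ N : ℕ, ∃ c ∈ A k a (hPoly k a b),
        algebraMap (B k) (FractionRing (B k)) (x k i) ^ N * q =
          algebraMap (B k) (FractionRing (B k)) c := by
  have hinj := IsFractionRing.injective (B k) (FractionRing (B k))
  constructor
  · rintro ⟨f, hf, rfl⟩ i
    obtain ⟨N, hN⟩ := exists_pow_mul_mem_A a b hf i
    exact ⟨N, _, hN, by simp⟩
  · intro h
    obtain ⟨m, c, hc, h0⟩ := h 0
    obtain ⟨n, d, hd, h1⟩ := h 1
    -- From q = c/x₁^m = d/x₂^n (the indices 0 and 1 here), unique divisibility by the prime x₁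
    -- forces x₁^m to divide c in B, so q lies in B. Two of the three variables suffice.
    have hcd : x k 1 ^ n * c = x k 0 ^ m * d := by
      apply hinj
      simp only [map_mul, map_pow, ← h0, ← h1]
      ring
    have hprime : Prime (x k 0) := MvPolynomial.X_prime
    have hndvd : ¬ x k 0 ∣ x k 1 := by
      intro hdvd
      have := map_dvd (MvPolynomial.eval (point (Pi.single 1 1) 0 0 : Vars → k)) hdvd
      simp [x, point] at this
    have hdvd : x k 0 ^ m ∣ c :=
      hprime.pow_dvd_of_dvd_mul_left m (fun h => hndvd (hprime.dvd_of_dvd_pow h)) ⟨d, hcd⟩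
    obtain ⟨f, rfl⟩ := hdvd
    have hx0 : x k 0 ^ m ≠ 0 := pow_ne_zero _ hprime.ne_zero
    refine ⟨f, ?_, ?_⟩
    · have hD : D k a b (x k 0 ^ m * f) = 0 := A_le_kernel a b hc
      rw [Derivation.leibniz, Derivation.leibniz_pow, D_x] at hD
      change D k a b f = 0
      simpa [hx0] using hD
    · rw [map_mul, map_pow] at h0
      exact (mul_left_cancel₀ (pow_ne_zero _ (algebraMap_x_ne_zero 0)) h0).symm

theorem image_kernel_eq_idealTransform :
    algebraMap (B k) (FractionRing (B k)) '' ((D k a b).kernel : Set (B k)) =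
      idealTransform (A k a (hPoly k a b)) (xIdealA k a (hPoly k a b)) := by
  ext q
  constructor
  · intro hq
    have hN := (mem_image_kernel_iff a b q).1 hq
    constructor
    · obtain ⟨N, c, hc, h⟩ := hN 0
      have : q = algebraMap (B k) (FractionRing (B k)) c /
          algebraMap (B k) (FractionRing (B k)) (x k 0) ^ N := by
        rw [← h, mul_div_cancel_left₀]
        exact pow_ne_zero _ (algebraMap_x_ne_zero 0)
      rw [this]
      exact div_mem (Subfield.subset_closure (Set.mem_image_of_mem _ hc))
        (pow_mem (Subfield.subset_closure (Set.mem_image_of_mem _ (x_mem_A a _ 0))) _)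
    -- `J` consists of the g in A with qg in A. Its radical contains each xᵢ, so some power of the
    -- finitely generated ideal I lies in `J`.
    · let J : Ideal (A k a (hPoly k a b)) :=
        { carrier := {g | ∃ c ∈ A k a (hPoly k a b), q * algebraMap (B k) (FractionRing (B k)) g =
            algebraMap (B k) (FractionRing (B k)) c}
          zero_mem' := ⟨0, zero_mem _, by simp⟩
          add_mem' := by
            rintro g g' ⟨c, hc, h⟩ ⟨c', hc', h'⟩
            exact ⟨c + c', add_mem hc hc', by simp [mul_add, h, h']⟩
          smul_mem' := by
            rintro r g ⟨c, hc, h⟩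
            refine ⟨r * c, mul_mem r.2 hc, ?_⟩
            simp only [smul_eq_mul, MulMemClass.coe_mul, map_mul, ← h]
            ring }
      have hle : xIdealA k a (hPoly k a b) ≤ J.radical := by
        rw [xIdealA_eq, Ideal.span_le]
        rintro _ ⟨i, rfl⟩
        obtain ⟨N, c, hc, h⟩ := hN i
        exact ⟨N, c, hc, by rw [← h]; simp [mul_comm]⟩
      obtain ⟨r, hr⟩ := Ideal.exists_pow_le_of_le_radical_of_fg hle (by
        rw [xIdealA_eq]
        exact Submodule.fg_span (Set.finite_range _))
      exact ⟨r + 1, by omega, fun g hg => hr (Ideal.pow_le_pow_right (Nat.le_succ r) hg)⟩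
  · rintro ⟨-, r, -, hr⟩
    refine (mem_image_kernel_iff a b q).2 fun i => ?_
    obtain ⟨c, hc, h⟩ := hr (⟨x k i, x_mem_A a _ i⟩ ^ r) (Ideal.pow_mem_pow (by
      rw [xIdealA_eq]
      exact Ideal.subset_span ⟨i, rfl⟩) r)
    exact ⟨r, c, hc, by rw [← h]; simp [mul_comm]⟩

open AlgebraicGeometry CategoryTheory in
theorem isRingOfRegularFunctions :
    IsRingOfRegularFunctions (A k a (hPoly k a b)) (D k a b).kernel
      (xIdealA k a (hPoly k a b)) := by
  have hinj := IsFractionRing.injective (B k) (FractionRing (B k))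
  have hdom : IsDomain (CommRingCat.of (A k a (hPoly k a b))) :=
    inferInstanceAs (IsDomain (A k a (hPoly k a b)))
  obtain ⟨ψ, hψ, hψA, hψr⟩ := exists_ringHom_regularFunctions
    (R := CommRingCat.of (A k a (hPoly k a b))) (K := FractionRing (B k))
    ((algebraMap (B k) (FractionRing (B k))).comp (A k a (hPoly k a b)).val.toRingHom)
    (hinj.comp Subtype.val_injective) (fun i => ⟨x k i, x_mem_A a _ i⟩)
    (fun i h => MvPolynomial.X_ne_zero (R := k) (Sum.inl i : Vars) (congrArg Subtype.val h))
    (specDiff (xIdealA k a (hPoly k a b))) (fun p => by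
      change ¬ ((xIdealA k a (hPoly k a b) : Set (A k a (hPoly k a b))) ⊆ p.asIdeal) ↔ _
      rw [SetLike.coe_subset_coe, xIdealA_eq, Ideal.span_le, Set.range_subset_iff, not_forall]
      rfl)
  let φ : (D k a b).kernel →+* FractionRing (B k) :=
    (algebraMap (B k) (FractionRing (B k))).comp (D k a b).kernel.val.toRingHom
  have hφ : Function.Injective φ := hinj.comp Subtype.val_injective
  -- Invariants and regular functions have the same image in the field of fractions of B, namely the
  -- q that each xᵢ carries into A by some power. The isomorphism is thus compatible with A.
  have hrange : φ.range = ψ.range := by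
    ext q
    rw [hψr]
    have h1 : q ∈ φ.range ↔
        q ∈ algebraMap (B k) (FractionRing (B k)) '' ((D k a b).kernel : Set (B k)) :=
      ⟨fun ⟨f, hf⟩ => ⟨f, f.2, hf⟩, fun ⟨f, hf, h⟩ => ⟨⟨f, hf⟩, h⟩⟩
    rw [h1, mem_image_kernel_iff]
    refine forall_congr' fun i => exists_congr fun N => ?_
    exact ⟨fun ⟨c, hc, h⟩ => ⟨⟨c, hc⟩, h⟩, fun ⟨c, h⟩ => ⟨c, c.2, h⟩⟩
  let e₁ := RingEquiv.ofBijective φ.rangeRestrict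
    ⟨fun f g h => hφ (congrArg Subtype.val h), φ.rangeRestrict_surjective⟩
  let e₂ := RingEquiv.ofBijective ψ.rangeRestrict
    ⟨fun f g h => hψ (congrArg Subtype.val h), ψ.rangeRestrict_surjective⟩
  refine ⟨A_le_kernel a b, (e₁.trans (RingEquiv.subringCongr hrange)).trans e₂.symm, fun c => ?_⟩
  rw [RingEquiv.trans_apply, RingEquiv.symm_apply_eq]
  exact Subtype.ext (hψA c).symm

end SevenDim

end

theorem lemma5p3 {k : Type*} [Field k] [IsAlgClosed k] [CharZero k] (a b : ℕ)
    (ha : 1 ≤ a) (hb : 1 ≤ b) :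
    -- `D` is locally nilpotent, and `B^D ⊆ k ⊕ (x₁, x₂, x₃)B`
    IsLND (SevenDim.D k a b) ∧
    Disjoint (1 : Submodule k (SevenDim.B k)) ((SevenDim.xIdeal k).restrictScalars k) ∧
    Subalgebra.toSubmodule (SevenDim.D k a b).kernel ≤
      (1 : Submodule k (SevenDim.B k)) ⊔ (SevenDim.xIdeal k).restrictScalars k ∧
    -- the elements `h₁, h₂, h₃` are polynomials, and the algebra `A` has the stated properties
    ∃ h : Fin 3 → SevenDim.B k,
      (∀ i, algebraMap (SevenDim.B k) (FractionRing (SevenDim.B k)) (h i) =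
        SevenDim.hFrac k a b i) ∧
      IsSeparatingAlgebra (SevenDim.A k a h) (SevenDim.D k a b).kernel ∧
      IsRingOfRegularFunctions (SevenDim.A k a h) (SevenDim.D k a b).kernel
        (SevenDim.xIdealA k a h) ∧
      algebraMap (SevenDim.B k) (FractionRing (SevenDim.B k)) ''
          ((SevenDim.D k a b).kernel : Set (SevenDim.B k)) =
        idealTransform (SevenDim.A k a h) (SevenDim.xIdealA k a h) := by
  exact ⟨SevenDim.isLND_D a b, SevenDim.disjoint_one_xIdeal,
    SevenDim.kernel_le_one_sup_xIdeal a b ha hb, SevenDim.hPoly k a b,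
    SevenDim.algebraMap_hPoly a b, SevenDim.isSeparatingAlgebra a b ha hb,
    SevenDim.isRingOfRegularFunctions a b, SevenDim.image_kernel_eq_idealTransform a b⟩
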